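/- Let $p$ be a prime number, let $R$ be a commutative Noetherian ring of characteristic $p$, and let $R \to S$ be a faithfully flat homomorphism of commutative Noetherian rings with regular fibers, that is, for every prime ideal $\mathfrak p$ of $R$, with residue field $\kappa(\mathfrak p) = R_{\mathfrak p}/\mathfrak p R_{\mathfrak p}$, the ring $\kappa(\mathfrak p) \otimes_R S$ is regular. For a Noetherian local ring $(A, \mathfrak m)$ of characteristic $p$ let $$e_{HK}(A) = \lim_{e \to \infty} \frac{\operatorname{length}_A\left(A/\mathfrak m^{[p^e]}\right)}{p^{e \dim A}}$$ be its Hilbert-Kunz multiplicity, where $\mathfrak m^{[p^e]}$ is the ideal generated by the $p^e$-th powers of the elements of $\mathfrak m$ (the limit exists by a theorem of Monsky). Then the function $\mathfrak q \mapsto e_{HK}(S_{\mathfrak q})$ is upper semi-continuous on $\operatorname{Spec} S$ if and only if the function $\mathfrak p \mapsto e_{HK}(R_{\mathfrak p})$ is upper semi-continuous on $\operatorname{Spec} R$. Here a real-valued function $f$ on a topological space $X$ is upper semi-continuous if $\{x \in X \mid f(x) < a\}$ is open for every real number $a$. -/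

import Mathlib

/-- The Frobenius-type power `I^{[q]}`: the ideal generated by the `q`-th powers of the elements
of `I`. -/
def frobeniusPower {A : Type*} [CommRing A] (I : Ideal A) (q : ℕ) : Ideal A :=
  Ideal.span ((fun x : A => x ^ q) '' (I : Set A))

/-- The normalized Hilbert-Kunz function `e ↦ length (A / m^{[p^e]}) / p^{e · dim A}` of a local
ring `(A, m)`. If `A` is Noetherian, then the dimension and all the lengths are finite, so passing
to natural numbers loses nothing. -/
noncomputable def hilbertKunzFunction (p : ℕ) (A : Type*) [CommRing A] [IsLocalRing A]
    (e : ℕ) : ℝ :=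
  ((Module.length A (A ⧸ frobeniusPower (IsLocalRing.maximalIdeal A) (p ^ e))).toNat : ℝ) /
    (p : ℝ) ^ (e * ((ringKrullDim A).unbotD 0).toNat)

/-- The Hilbert-Kunz multiplicity of a local ring: the limit of its normalized Hilbert-Kunz
function. By a theorem of Monsky the limit exists in `ℝ` for every Noetherian local ring of prime
characteristic `p`. -/
noncomputable def hilbertKunzMultiplicity (p : ℕ) (A : Type*) [CommRing A] [IsLocalRing A] : ℝ :=
  Filter.limUnder Filter.atTop (hilbertKunzFunction p A)

/-- The Hilbert-Kunz multiplicity as a real-valued function on `Spec R`, whose value at a prime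
is the Hilbert-Kunz multiplicity of the local ring at that prime. -/
noncomputable def hilbertKunzSpec (p : ℕ) (R : Type*) [CommRing R] (x : PrimeSpectrum R) : ℝ :=
  hilbertKunzMultiplicity p (Localization.AtPrime x.asIdeal)

/-- An `R`-algebra `S` has regular fibers if `κ(x) ⊗[R] S` is a regular ring for every prime `x`
of `R`. -/
def HasRegularFibers (R S : Type*) [CommRing R] [CommRing S] [Algebra R S] : Prop :=
  ∀ x : PrimeSpectrum R, IsRegularRing (x.asIdeal.Fiber S)

/-!
The reason for the equivalence is that `e_HK(S_q) = e_HK(R_p)` for every prime `q` of `S` with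
contraction `p`, so that the function on `Spec S` is the pullback of the one on `Spec R` along
`Spec S → Spec R`. This map is a topological quotient map, because `S` is faithfully flat over `R`,
and upper semicontinuity, the openness of the sets `{f < a}`, therefore holds on `Spec S` if and
only if it holds on `Spec R`.

No limit has to be taken for the comparison of multiplicities: the normalized Hilbert-Kunz functions
of `A = R_p` and `B = S_q` agree term by term (`hilbertKunzFunction_eq_of_flat`). Indeed `A → B` is a
flat local homomorphism, and its closed fiber `F = B / m_A B` is regular, being a localization of
`κ(p) ⊗ S`. Let `d = dim F` and lift generators of the maximal ideal of `F` to `x₁, …, x_d` in `B`.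
For `Q = p ^ e` (now with `p` the characteristic), additivity of Frobenius gives
`m_B^{[Q]} = m_A^{[Q]} B + (x₁^Q, …, x_d^Q)`. The length of the quotient of `B` by this ideal is
`ℓ(A / m_A^{[Q]}) * Q ^ d` (`length_quotient_frobeniusPower_eq`), while `dim B = dim A + d`.

The length is computed from three facts.
* In the regular local ring `F` the generators of the maximal ideal form a regular sequence
  (`isWeaklyRegular_of_ofList_eq_maximalIdeal`), since regular local rings are domains.
* For a weakly regular sequence `rs` on `M₁` and `M₃` and an extension
  `0 → M₁ → M₂ → M₃ → 0`, the sequence is weakly regular on `M₂`, and `ℓ(Mᵢ / rs Mᵢ)` is additive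
  (`isWeaklyRegular_and_length_of_exact`). Filtering `M / x^Q M` by copies of `M / xM`, it follows that
  replacing the members of the sequence by their `Q`-th powers multiplies the length by `Q ^ d`
  (`isWeaklyRegular_and_length_map_pow`).
* By flatness, the same additivity along a composition series of `A / m_A^{[Q]}` reduces the length
  over `B` to the one over the closed fiber (`isWeaklyRegular_and_length_baseChange`). This
  replaces the local criterion of flatness.
-/

open RingTheory.Sequence Function Submodule Pointwise TensorProduct

/-! ### Lengths modulo weakly regular sequences -/

section WeaklyRegular

variable {B : Type*} [CommRing B]

lemma isWeaklyRegular_of_subsingleton {M : Type*} [AddCommGroup M] [Module B M] [Subsingleton M]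
    (rs : List B) : IsWeaklyRegular M rs := by
  induction rs generalizing M with
  | nil => exact .nil B M
  | cons r rs ih => exact .cons (injective_of_subsingleton _) ih

lemma length_quotient_ofList_nil (M : Type*) [AddCommGroup M] [Module B M] :
    Module.length B (M ⧸ (Ideal.ofList ([] : List B) • ⊤ : Submodule B M)) =
      Module.length B M :=
  (quotEquivOfEqBot _ (by simp)).length_eq

lemma length_quotient_ofList_cons (M : Type*) [AddCommGroup M] [Module B M] (r : B)
    (rs : List B) :
    Module.length B (M ⧸ (Ideal.ofList (r :: rs) • ⊤ : Submodule B M)) =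
      Module.length B (QuotSMulTop r M ⧸ (Ideal.ofList rs • ⊤ : Submodule B (QuotSMulTop r M))) :=
  (quotOfListConsSMulTopEquivQuotSMulTopInner M r rs).length_eq

lemma length_quotient_ofList_congr {M N : Type*} [AddCommGroup M] [Module B M] [AddCommGroup N]
    [Module B N] (e : M ≃ₗ[B] N) (rs : List B) :
    Module.length B (M ⧸ (Ideal.ofList rs • ⊤ : Submodule B M)) =
      Module.length B (N ⧸ (Ideal.ofList rs • ⊤ : Submodule B N)) :=
  (Submodule.Quotient.equiv _ _ e (by simp [Submodule.map_smul''])).length_eq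

/-- Weak regularity passes to extensions, and on modules on which a sequence is weakly regular the
length of the quotient by the sequence is additive. -/
theorem isWeaklyRegular_and_length_of_exact {M₁ M₂ M₃ : Type*} [AddCommGroup M₁] [Module B M₁]
    [AddCommGroup M₂] [Module B M₂] [AddCommGroup M₃] [Module B M₃]
    {f : M₁ →ₗ[B] M₂} {g : M₂ →ₗ[B] M₃} (hf : Injective f) (hfg : Exact f g)
    (hg : Surjective g) {rs : List B} (h₁ : IsWeaklyRegular M₁ rs) (h₃ : IsWeaklyRegular M₃ rs) :
    IsWeaklyRegular M₂ rs ∧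
      Module.length B (M₂ ⧸ (Ideal.ofList rs • ⊤ : Submodule B M₂)) =
        Module.length B (M₁ ⧸ (Ideal.ofList rs • ⊤ : Submodule B M₁)) +
          Module.length B (M₃ ⧸ (Ideal.ofList rs • ⊤ : Submodule B M₃)) := by
  induction rs generalizing M₁ M₂ M₃ with
  | nil =>
    simp only [length_quotient_ofList_nil]
    exact ⟨.nil B M₂, Module.length_eq_add_of_exact f g hf hg hfg⟩
  | cons r rs ih =>
    rw [isWeaklyRegular_cons_iff] at h₁ h₃ ⊢
    -- Regularity of `r` on `M₃` keeps `0 → M₁ → M₂` exact modulo `r`.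
    have h0 : Exact (0 : PUnit →ₗ[B] M₁) f := (LinearMap.exact_zero_iff_injective _ f).mpr hf
    have hinj : Injective (QuotSMulTop.map r f) := by
      have := QuotSMulTop.map_first_exact_on_four_term_exact_of_isSMulRegular_last h0 hfg h₃.1
      rw [map_zero] at this
      exact (LinearMap.exact_zero_iff_injective _ _).mp this
    obtain ⟨hreg, hlen⟩ := ih hinj (QuotSMulTop.map_exact r hfg hg)
      (QuotSMulTop.map_surjective r hg) h₁.2 h₃.2
    simp only [length_quotient_ofList_cons]
    exact ⟨⟨isSMulRegular_of_range_eq_ker hf hfg.linearMap_ker_eq.symm h₁.1 h₃.1, hreg⟩, hlen⟩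

/-- Multiplication by `x`, as a map `M / yM → M / xyM`. -/
def quotSMulTopMul (x y : B) (M : Type*) [AddCommGroup M] [Module B M] :
    QuotSMulTop y M →ₗ[B] QuotSMulTop (x * y) M :=
  mapQ _ _ (LinearMap.lsmul B M x) <| by
    intro m hm
    obtain ⟨n, -, rfl⟩ := (mem_smul_pointwise_iff_exists ..).mp hm
    exact (mem_smul_pointwise_iff_exists ..).mpr ⟨n, trivial, mul_smul x y n⟩

/-- The projection `M / xyM → M / xM`. -/
def quotSMulTopFactor (x y : B) (M : Type*) [AddCommGroup M] [Module B M] :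
    QuotSMulTop (x * y) M →ₗ[B] QuotSMulTop x M :=
  mapQ _ _ LinearMap.id <| by
    intro m hm
    obtain ⟨n, -, rfl⟩ := (mem_smul_pointwise_iff_exists ..).mp hm
    exact (mem_smul_pointwise_iff_exists ..).mpr ⟨y • n, trivial, (mul_smul x y n).symm⟩

lemma quotSMulTopFactor_surjective (x y : B) (M : Type*) [AddCommGroup M] [Module B M] :
    Surjective (quotSMulTopFactor x y M) :=
  fun m => by
    obtain ⟨m, rfl⟩ := Submodule.Quotient.mk_surjective _ m
    exact ⟨Submodule.Quotient.mk m, rfl⟩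

lemma quotSMulTopMul_injective {x : B} (y : B) {M : Type*} [AddCommGroup M] [Module B M]
    (hx : IsSMulRegular M x) : Injective (quotSMulTopMul x y M) := by
  rw [injective_iff_map_eq_zero]
  intro m hm
  obtain ⟨m, rfl⟩ := Submodule.Quotient.mk_surjective _ m
  have hm' : x • m ∈ (x * y) • (⊤ : Submodule B M) := (Submodule.Quotient.mk_eq_zero _).mp hm
  obtain ⟨n, -, hn⟩ := (mem_smul_pointwise_iff_exists ..).mp hm'
  rw [mul_smul] at hn
  exact (Submodule.Quotient.mk_eq_zero _).mpr
    ((mem_smul_pointwise_iff_exists ..).mpr ⟨n, trivial, hx hn⟩)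

lemma exact_quotSMulTopMul_quotSMulTopFactor (x y : B) (M : Type*) [AddCommGroup M] [Module B M] :
    Exact (quotSMulTopMul x y M) (quotSMulTopFactor x y M) := by
  intro m
  obtain ⟨m, rfl⟩ := Submodule.Quotient.mk_surjective _ m
  constructor
  · intro hm
    have hm' : m ∈ x • (⊤ : Submodule B M) := (Submodule.Quotient.mk_eq_zero _).mp hm
    obtain ⟨n, -, rfl⟩ := (mem_smul_pointwise_iff_exists ..).mp hm'
    exact ⟨Submodule.Quotient.mk n, rfl⟩
  · rintro ⟨n, hn⟩
    obtain ⟨n, rfl⟩ := Submodule.Quotient.mk_surjective _ n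
    rw [← hn]
    exact (Submodule.Quotient.mk_eq_zero _).mpr
      ((mem_smul_pointwise_iff_exists ..).mpr ⟨n, trivial, rfl⟩)

/-- The module `M / x^a M` is filtered by `a` copies of `M / xM`. -/
lemma isWeaklyRegular_and_length_quotSMulTop_pow {M : Type*} [AddCommGroup M] [Module B M] {x : B}
    (hx : IsSMulRegular M x) {rs : List B} (h : IsWeaklyRegular (QuotSMulTop x M) rs) (a : ℕ) :
    IsWeaklyRegular (QuotSMulTop (x ^ a) M) rs ∧
      Module.length B (QuotSMulTop (x ^ a) M ⧸
          (Ideal.ofList rs • ⊤ : Submodule B (QuotSMulTop (x ^ a) M))) =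
        a * Module.length B (QuotSMulTop x M ⧸
          (Ideal.ofList rs • ⊤ : Submodule B (QuotSMulTop x M))) := by
  induction a with
  | zero =>
    have : Subsingleton (QuotSMulTop (x ^ 0) M) :=
      Submodule.Quotient.subsingleton_iff.mpr (by simp)
    exact ⟨isWeaklyRegular_of_subsingleton rs, by simp⟩
  | succ a ih =>
    rw [pow_succ']
    obtain ⟨h1, h2⟩ := isWeaklyRegular_and_length_of_exact (quotSMulTopMul_injective (x ^ a) hx)
      (exact_quotSMulTopMul_quotSMulTopFactor x (x ^ a) M)
      (quotSMulTopFactor_surjective x (x ^ a) M) ih.1 h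
    exact ⟨h1, by rw [h2, ih.2]; push_cast; ring⟩

/-- Replacing every member of a weakly regular sequence of `d` elements by its `a`-th power keeps it
weakly regular and multiplies the length of the quotient by `a ^ d`. -/
theorem isWeaklyRegular_and_length_map_pow {M : Type*} [AddCommGroup M] [Module B M]
    {rs : List B} (h : IsWeaklyRegular M rs) (a : ℕ) :
    IsWeaklyRegular M (rs.map (· ^ a)) ∧
      Module.length B (M ⧸ (Ideal.ofList (rs.map (· ^ a)) • ⊤ : Submodule B M)) =
        (a : ℕ∞) ^ rs.length * Module.length B (M ⧸ (Ideal.ofList rs • ⊤ : Submodule B M)) := by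
  induction rs generalizing M with
  | nil => exact ⟨h, by rw [List.map_nil, List.length_nil, pow_zero, one_mul]⟩
  | cons x rs ih =>
    rw [isWeaklyRegular_cons_iff] at h
    obtain ⟨h1, h2⟩ := ih h.2
    obtain ⟨h3, h4⟩ := isWeaklyRegular_and_length_quotSMulTop_pow h.1 h1 a
    rw [List.map_cons, length_quotient_ofList_cons, length_quotient_ofList_cons, h4, h2,
      List.length_cons]
    exact ⟨.cons (h.1.pow a) h3, by ring⟩

end WeaklyRegular

/-- A sequence in a flat algebra `B` over a local ring `A` that is weakly regular on the closed
fiber is weakly regular on the base change of every `A`-module `N` of finite length, and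
modulo the sequence the length of the base change is proportional to the length of `N`. -/
theorem isWeaklyRegular_and_length_baseChange {A B : Type*} [CommRing A] [IsLocalRing A]
    [CommRing B] [Algebra A B] [Module.Flat A B] {rs : List B}
    (h : IsWeaklyRegular (B ⊗[A] (A ⧸ IsLocalRing.maximalIdeal A)) rs)
    {N : Type*} [AddCommGroup N] [Module A N] (hN : IsFiniteLength A N) :
    IsWeaklyRegular (B ⊗[A] N) rs ∧
      Module.length B ((B ⊗[A] N) ⧸ (Ideal.ofList rs • ⊤ : Submodule B (B ⊗[A] N))) =
        Module.length A N * Module.length B ((B ⊗[A] (A ⧸ IsLocalRing.maximalIdeal A)) ⧸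
          (Ideal.ofList rs • ⊤ : Submodule B (B ⊗[A] (A ⧸ IsLocalRing.maximalIdeal A)))) := by
  induction hN with
  | of_subsingleton => exact ⟨isWeaklyRegular_of_subsingleton rs, by simp⟩
  | @of_simple_quotient M _ _ N hs _ ih =>
    -- The simple quotient `M / N` is the residue field, so its base change is the closed fiber.
    obtain ⟨m, hm, ⟨e⟩⟩ := isSimpleModule_iff_quot_maximal.mp hs
    obtain rfl := IsLocalRing.eq_maximalIdeal hm
    have hex : Exact (TensorProduct.AlgebraTensorModule.lTensor B B N.subtype)
        (TensorProduct.AlgebraTensorModule.lTensor B B N.mkQ) :=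
      lTensor_exact B (LinearMap.exact_subtype_mkQ N) N.mkQ_surjective
    have hinj : Injective (TensorProduct.AlgebraTensorModule.lTensor B B N.subtype) :=
      Module.Flat.lTensor_preserves_injective_linearMap N.subtype N.subtype_injective
    have hsurj : Surjective (TensorProduct.AlgebraTensorModule.lTensor B B N.mkQ) :=
      LinearMap.lTensor_surjective B N.mkQ_surjective
    have e' := e.baseChange A B _ _
    obtain ⟨h1, h2⟩ := isWeaklyRegular_and_length_of_exact hinj hex hsurj ih.1
      ((e'.isWeaklyRegular_congr rs).mpr h)
    refine ⟨h1, ?_⟩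
    rw [h2, ih.2, length_quotient_ofList_congr e' rs,
      Module.length_eq_add_of_exact N.subtype N.mkQ N.subtype_injective N.mkQ_surjective
        (LinearMap.exact_subtype_mkQ N), Module.length_eq_one A (M ⧸ N), add_mul, one_mul]

/-! ### Regular local rings -/

section RegularLocal

open IsLocalRing

/-- If `x ∈ m` is part of a minimal generating system of `m`, i.e. `x ∉ m²`, then it can replace
one of the generators in any finite generating system. -/
lemma exists_ideal_eq_span_singleton_sup_span_diff {F : Type*} [CommRing F] [IsLocalRing F]
    {G : Set F} (hfin : G.Finite) (hG : Ideal.span G = maximalIdeal F) {x : F}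
    (hx : x ∈ maximalIdeal F) (hx2 : x ∉ maximalIdeal F ^ 2) :
    ∃ g ∈ G, maximalIdeal F = Ideal.span {x} ⊔ Ideal.span (G \ {g}) := by
  classical
  lift G to Finset F using hfin
  have hGm : ∀ g ∈ G, g ∈ maximalIdeal F := fun g hg => hG ▸ Ideal.subset_span hg
  rw [← hG] at hx
  obtain ⟨f, hf⟩ := Submodule.mem_span_finset'.mp hx
  obtain ⟨g, hg⟩ : ∃ g : (G : Finset F), IsUnit (f g) := by
    by_contra! h
    refine hx2 (hf ▸ sum_mem fun g _ => ?_)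
    rw [pow_two]
    exact Ideal.mul_mem_mul ((mem_maximalIdeal _).mpr (h g)) (hGm g g.2)
  refine ⟨g, g.2, le_antisymm ?_ ?_⟩
  · rw [← hG, Ideal.span_le]
    intro y hy
    by_cases hyg : y = g
    · subst hyg
      have hsum : (∑ a ∈ Finset.univ.erase g, f a • (a : F)) ∈
          Ideal.span ((G : Set F) \ {(g : F)}) := by
        refine sum_mem fun a ha => Ideal.mul_mem_left _ _ (Ideal.subset_span ⟨a.2, ?_⟩)
        exact fun h => Finset.ne_of_mem_erase ha (Subtype.ext h)
      have : f g * (g : F) = x - ∑ a ∈ Finset.univ.erase g, f a • (a : F) := by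
        rw [← hf, ← Finset.add_sum_erase _ _ (Finset.mem_univ g), smul_eq_mul, add_sub_cancel_right]
      rw [SetLike.mem_coe, ← Ideal.unit_mul_mem_iff_mem _ hg, this]
      exact sub_mem (Ideal.mem_sup_left (Ideal.mem_span_singleton_self x))
        (Ideal.mem_sup_right hsum)
    · exact Ideal.mem_sup_right (Ideal.subset_span ⟨hy, hyg⟩)
  · rw [← hG, sup_le_iff, Ideal.span_singleton_le_iff_mem]
    exact ⟨hx, Ideal.span_mono Set.sdiff_subset⟩

/-- If the maximal ideal of `F` is generated by `x` and at most `n` further elements, and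
`dim F = n + 1`, then `F / x` is regular of dimension `n`. -/
lemma isRegularLocalRing_quotient_span_singleton {F : Type*} [CommRing F] [IsLocalRing F]
    [IsNoetherianRing F] {n : ℕ} (hdim : ringKrullDim F = (n + 1 : ℕ)) {x : F} {T : Set F}
    (hT : T.Finite) (hn : T.ncard ≤ n) (h : maximalIdeal F = Ideal.span {x} ⊔ Ideal.span T) :
    IsRegularLocalRing (F ⧸ Ideal.span {x}) ∧ ringKrullDim (F ⧸ Ideal.span {x}) = n := by
  have hx : x ∈ maximalIdeal F := h ▸ Ideal.mem_sup_left (Ideal.mem_span_singleton_self x)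
  have : Nontrivial (F ⧸ Ideal.span {x}) := Ideal.Quotient.nontrivial_iff.mpr
    (((Ideal.span_singleton_le_iff_mem _).mpr hx).trans_lt
      (lt_top_iff_ne_top.mpr Ideal.IsPrime.ne_top')).ne
  have hloc : IsLocalRing (F ⧸ Ideal.span {x}) :=
    .of_surjective' (Ideal.Quotient.mk _) Ideal.Quotient.mk_surjective
  have hmax : maximalIdeal (F ⧸ Ideal.span {x}) =
      Ideal.span (Ideal.Quotient.mk (Ideal.span {x}) '' T) := by
    rw [← IsLocalRing.map_maximalIdeal_of_surjective (Ideal.Quotient.mk (Ideal.span {x}))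
      Ideal.Quotient.mk_surjective, h, Ideal.map_sup, Ideal.map_quotient_self, bot_sup_eq,
      Ideal.map_span]
  have hrank : (maximalIdeal (F ⧸ Ideal.span {x})).spanFinrank ≤ n := by
    rw [hmax]
    exact (Submodule.spanFinrank_span_le_ncard_of_finite (hT.image _)).trans
      ((Set.ncard_image_le hT).trans hn)
  have hle : ringKrullDim (F ⧸ Ideal.span {x}) ≤ n :=
    (ringKrullDim_le_spanFinrank_maximalIdeal _).trans (by exact_mod_cast hrank)
  have hge : (n : WithBot ℕ∞) ≤ ringKrullDim (F ⧸ Ideal.span {x}) := by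
    have := ringKrullDim_le_ringKrullDim_quotient_add_card ({x} : Finset F)
      (by simpa [ringJacobson_eq_maximalIdeal] using hx)
    rw [hdim, Finset.coe_singleton, Finset.card_singleton] at this
    push_cast at this
    exact ENat.WithBot.add_le_add_one_right_iff.mp this
  have heq := le_antisymm hle hge
  exact ⟨.of_spanFinrank_maximalIdeal_le _ (heq ▸ by exact_mod_cast hrank), heq⟩

/-- Regular local rings are domains. The dimension is fixed as `n` to allow induction: for `x ∈ m`
outside `m²` and outside all minimal primes, `F / x` is regular of dimension `n - 1`, so `(x)` is a
prime that strictly contains a minimal prime. -/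
theorem IsRegularLocalRing.isDomain_of_ringKrullDim_eq {n : ℕ} {F : Type*} [CommRing F]
    [IsRegularLocalRing F] (hdim : ringKrullDim F = n) : IsDomain F := by
  induction n generalizing F with
  | zero =>
    have h0 := IsRegularLocalRing.spanFinrank_maximalIdeal (R := F)
    rw [hdim, Nat.cast_inj, Submodule.spanFinrank_eq_zero_iff_eq_bot
      (maximalIdeal F).fg_of_isNoetherianRing] at h0
    exact (isField_iff_maximalIdeal_eq.mpr h0).isDomain
  | succ n ih =>
    have hfg : Submodule.FG (maximalIdeal F) := (maximalIdeal F).fg_of_isNoetherianRing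
    have hbot : maximalIdeal F ≠ ⊥ := by
      intro h
      rw [ringKrullDim_eq_zero_of_isField (isField_iff_maximalIdeal_eq.mpr h)] at hdim
      exact absurd hdim.symm (by exact_mod_cast Nat.succ_ne_zero n)
    have hsq : ¬ maximalIdeal F ≤ maximalIdeal F ^ 2 := fun h =>
      hbot (Submodule.eq_bot_of_le_smul_of_le_jacobson_bot _ _ hfg
        (by rwa [smul_eq_mul, ← pow_two]) (IsLocalRing.maximalIdeal_le_jacobson _))
    have hmin : ∀ P ∈ minimalPrimes F, ¬ maximalIdeal F ≤ P := by
      intro P hP h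
      have := hP.1.1
      obtain rfl := (maximalIdeal.isMaximal F).eq_of_le this.ne_top h
      rw [← maximalIdeal_height_eq_ringKrullDim, Ideal.height_eq_zero_iff.mpr hP] at hdim
      exact absurd hdim.symm (by exact_mod_cast Nat.succ_ne_zero n)
    -- Prime avoidance, which tolerates the single non-prime ideal `m²`.
    obtain ⟨x, hx, hxs⟩ : ∃ x ∈ maximalIdeal F,
        x ∉ ⋃ I ∈ insert (maximalIdeal F ^ 2) (minimalPrimes F), (I : Set F) := by
      by_contra! h
      obtain ⟨I, hI, hle⟩ := (Ideal.subset_union_prime_finite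
        ((minimalPrimes.finite_of_isNoetherianRing F).insert _) (f := id)
        (maximalIdeal F ^ 2) (maximalIdeal F ^ 2)
        (fun I hI h _ => (hI.resolve_left h).1.1)).mp h
      rcases hI with rfl | hI
      · exact hsq hle
      · exact hmin I hI hle
    simp only [Set.mem_iUnion, not_exists, Set.mem_insert_iff] at hxs
    obtain ⟨g, hg, hspan⟩ := exists_ideal_eq_span_singleton_sup_span_diff
      hfg.finite_generators (maximalIdeal F).span_generators hx (hxs _ (.inl rfl))
    have hcard : ((maximalIdeal F).generators \ {g}).ncard ≤ n := by
      have h0 := IsRegularLocalRing.spanFinrank_maximalIdeal (R := F)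
      rw [hdim, Nat.cast_inj, ← hfg.generators_ncard] at h0
      rw [Set.ncard_sdiff_singleton_of_mem hg, h0, Nat.add_sub_cancel]
    obtain ⟨hreg, hd⟩ := isRegularLocalRing_quotient_span_singleton hdim
      (hfg.finite_generators.sdiff) hcard hspan
    have := ih hd
    have hprime : (Ideal.span {x}).IsPrime := (Ideal.Quotient.isDomain_iff_prime _).mp this
    -- A minimal prime `P ⊆ (x)` does not contain `x`, so `P = xP`, which forces `P = 0`.
    obtain ⟨P, hP, hPx⟩ := Ideal.exists_minimalPrimes_le (bot_le (a := Ideal.span {x}))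
    have hPp : P.IsPrime := hP.1.1
    have hxP : x ∉ P := hxs P (.inr hP)
    have hPbot : P = ⊥ := by
      refine Submodule.eq_bot_of_le_smul_of_le_jacobson_bot (Ideal.span {x}) P
        P.fg_of_isNoetherianRing ?_ (((Ideal.span_singleton_le_iff_mem _).mpr hx).trans
          (IsLocalRing.maximalIdeal_le_jacobson _))
      intro y hy
      obtain ⟨z, rfl⟩ := Ideal.mem_span_singleton.mp (hPx hy)
      exact Ideal.mul_mem_mul (Ideal.mem_span_singleton_self x)
        ((hPp.mem_or_mem hy).resolve_left hxP)
    subst hPbot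
    exact (IsDomain.of_bot_isPrime F)

/-- In a regular local ring of dimension `d`, any `d` generators of the maximal ideal form a
regular sequence. -/
theorem isWeaklyRegular_of_ofList_eq_maximalIdeal {F : Type*} [CommRing F] [IsRegularLocalRing F]
    {rs : List F} (hrs : Ideal.ofList rs = maximalIdeal F) (hdim : ringKrullDim F = rs.length) :
    IsWeaklyRegular F rs := by
  classical
  generalize hn : rs.length = n at hdim
  induction n generalizing F rs with
  | zero =>
    rw [List.length_eq_zero_iff] at hn
    exact hn ▸ .nil F F
  | succ n ih =>
    obtain ⟨x, rs, rfl⟩ := List.exists_cons_of_length_eq_add_one hn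
    have hlen : rs.length = n := by simpa using hn
    have := IsRegularLocalRing.isDomain_of_ringKrullDim_eq hdim
    have hT : ∀ l : List F, Ideal.ofList l = Ideal.span (l.toFinset : Set F) := fun l => by
      simp [Ideal.ofList]
    have hcard : ((rs.toFinset : Set F)).ncard ≤ n := by
      rw [Set.ncard_coe_finset]
      exact hlen ▸ rs.toFinset_card_le
    -- If `x = 0`, then `m` would be generated by fewer than `dim F` elements.
    have hx : x ≠ 0 := by
      rintro rfl
      have h1 : (maximalIdeal F).spanFinrank ≤ n := by
        rw [← hrs, Ideal.ofList_cons, Ideal.span_singleton_zero, bot_sup_eq, hT]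
        exact (Submodule.spanFinrank_span_le_ncard_of_finite (Finset.finite_toSet _)).trans hcard
      have h2 := IsRegularLocalRing.spanFinrank_maximalIdeal (R := F)
      rw [hdim, Nat.cast_inj] at h2
      omega
    obtain ⟨hreg, hd⟩ := isRegularLocalRing_quotient_span_singleton hdim
      (Finset.finite_toSet rs.toFinset) hcard (by rw [← hrs, Ideal.ofList_cons, hT rs])
    have h := ih (F := F ⧸ Ideal.span {x}) (rs := rs.map (Ideal.Quotient.mk _)) (by
      rw [← IsLocalRing.map_maximalIdeal_of_surjective (Ideal.Quotient.mk (Ideal.span {x}))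
        Ideal.Quotient.mk_surjective, ← hrs, Ideal.ofList_cons, Ideal.map_sup,
        Ideal.map_quotient_self, bot_sup_eq, Ideal.map_ofList]) (by simpa using hlen) hd
    have h' : IsWeaklyRegular (F ⧸ Ideal.span {x}) rs :=
      (isWeaklyRegular_map_algebraMap_iff (F ⧸ Ideal.span {x}) (F ⧸ Ideal.span {x}) rs).mp h
    have e : QuotSMulTop x F ≃ₗ[F] F ⧸ Ideal.span {x} :=
      Submodule.quotEquivOfEq _ _ (by
        rw [← Submodule.ideal_span_singleton_smul, smul_eq_mul, Ideal.mul_top])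
    exact .cons (IsSMulRegular.of_ne_zero hx) ((e.isWeaklyRegular_congr rs).mpr h')

end RegularLocal

section HilbertKunz

open IsLocalRing

/-! ### Frobenius powers and lengths -/

/-- In characteristic `p` the ideal `I^{[p^e]}` is the extension of `I` along the `e`-th iterate of
Frobenius, so that it may be computed from any generators of `I`. -/
lemma frobeniusPower_eq_map {A : Type*} [CommRing A] (p : ℕ) [ExpChar A p] (I : Ideal A) (e : ℕ) :
    frobeniusPower I (p ^ e) = I.map (iterateFrobenius A p e) :=
  rfl

lemma frobeniusPower_sup {A : Type*} [CommRing A] (p : ℕ) [ExpChar A p] (I J : Ideal A) (e : ℕ) :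
    frobeniusPower (I ⊔ J) (p ^ e) = frobeniusPower I (p ^ e) ⊔ frobeniusPower J (p ^ e) := by
  simp_rw [frobeniusPower_eq_map, Ideal.map_sup]

lemma frobeniusPower_ofList {A : Type*} [CommRing A] (p : ℕ) [ExpChar A p] (rs : List A) (e : ℕ) :
    frobeniusPower (Ideal.ofList rs) (p ^ e) = Ideal.ofList (rs.map (· ^ p ^ e)) := by
  rw [frobeniusPower_eq_map, Ideal.map_ofList]
  rfl

lemma frobeniusPower_map {A B : Type*} [CommRing A] [CommRing B] (p : ℕ) [ExpChar A p]
    [ExpChar B p] (f : A →+* B) (I : Ideal A) (e : ℕ) :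
    frobeniusPower (I.map f) (p ^ e) = (frobeniusPower I (p ^ e)).map f := by
  simp_rw [frobeniusPower_eq_map, Ideal.map_map]
  congr 1
  ext x
  simp [iterateFrobenius_def]

lemma isFiniteLength_quotient_frobeniusPower {A : Type*} [CommRing A] [IsLocalRing A]
    [IsNoetherianRing A] {q : ℕ} (hq : q ≠ 0) :
    IsFiniteLength A (A ⧸ frobeniusPower (maximalIdeal A) q) := by
  have hmin : maximalIdeal A ∈ (frobeniusPower (maximalIdeal A) q).minimalPrimes := by
    refine ⟨⟨Ideal.IsMaximal.isPrime' _, ?_⟩, fun P hP _ x hx => ?_⟩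
    · rw [frobeniusPower, Ideal.span_le]
      rintro _ ⟨x, hx, rfl⟩
      exact Ideal.pow_mem_of_mem _ hx q hq.bot_lt
    · have := hP.1
      exact Ideal.IsPrime.mem_of_pow_mem this q (hP.2 (Ideal.subset_span ⟨x, hx, rfl⟩))
  have := quotient_artinian_of_mem_minimalPrimes_of_isLocalRing _ hmin
  rw [isFiniteLength_iff_isNoetherian_isArtinian]
  exact ⟨inferInstance, isArtinian_of_surjective_algebraMap
    (Ideal.Quotient.mk_surjective (I := frobeniusPower (maximalIdeal A) q))⟩

lemma length_quotient_quotient_ofList {B : Type*} [CommRing B] (I : Ideal B) (rs : List B) :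
    Module.length B ((B ⧸ I) ⧸ (Ideal.ofList rs • ⊤ : Submodule B (B ⧸ I))) =
      Module.length B (B ⧸ (I ⊔ Ideal.ofList rs)) := by
  have h : (Ideal.ofList rs • ⊤ : Submodule B (B ⧸ I)) =
      Submodule.map I.mkQ (I ⊔ Ideal.ofList rs) := by
    rw [← I.range_mkQ, LinearMap.range_eq_map, ← Submodule.map_smul'', smul_eq_mul, Ideal.mul_top,
      Submodule.map_sup, Submodule.mkQ_map_self, bot_sup_eq]
  exact ((Submodule.quotEquivOfEq _ _ h).trans
    (Submodule.quotientQuotientEquivQuotient I _ le_sup_left)).length_eq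

/-- The maximal ideal of a regular local ring of dimension `d` is generated by a list of `d`
elements. -/
lemma exists_list_ofList_eq_maximalIdeal (F : Type*) [CommRing F] [IsRegularLocalRing F] :
    ∃ rs : List F, Ideal.ofList rs = maximalIdeal F ∧ ringKrullDim F = rs.length := by
  have hfg : Submodule.FG (maximalIdeal F) := (maximalIdeal F).fg_of_isNoetherianRing
  have hfin := hfg.finite_generators
  refine ⟨hfin.toFinset.toList, ?_, ?_⟩
  · simpa [Ideal.ofList] using (maximalIdeal F).span_generators
  · rw [← IsRegularLocalRing.spanFinrank_maximalIdeal, ← hfg.generators_ncard,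
      Finset.length_toList, Set.ncard_eq_toFinset_card _ hfin]

/-! ### Flat local extensions with regular closed fiber -/

section LocalExtension

variable {A B : Type*} [CommRing A] [IsLocalRing A] [IsNoetherianRing A] [CommRing B]
  [IsLocalRing B] [Algebra A B] [IsLocalHom (algebraMap A B)]
  [Module.Flat A B]

lemma ringKrullDim_eq_add_of_flat [IsNoetherianRing B]
    [IsLocalRing (B ⧸ (maximalIdeal A).map (algebraMap A B))] :
    ringKrullDim B =
      ringKrullDim A + ringKrullDim (B ⧸ (maximalIdeal A).map (algebraMap A B)) := by
  have : (maximalIdeal B).LiesOver (maximalIdeal A) :=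
    ⟨(IsLocalRing.maximalIdeal_comap (algebraMap A B)).symm⟩
  have h := Ideal.height_eq_height_add_of_liesOver_of_hasGoingDown (maximalIdeal A) (maximalIdeal B)
  rw [map_maximalIdeal_of_surjective _ Ideal.Quotient.mk_surjective] at h
  simp_rw [← maximalIdeal_height_eq_ringKrullDim]
  exact_mod_cast h

/-- For a flat local extension `A → B` in characteristic `p` with regular closed fiber of dimension
`d`, one has `ℓ(B / m_B^{[q]}) = ℓ(A / m_A^{[q]}) * q ^ d`. -/
theorem length_quotient_frobeniusPower_eq (p : ℕ) [Fact p.Prime] [CharP A p] [CharP B p]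
    [IsRegularLocalRing (B ⧸ (maximalIdeal A).map (algebraMap A B))] {d : ℕ}
    (hd : ringKrullDim (B ⧸ (maximalIdeal A).map (algebraMap A B)) = d) (e : ℕ) :
    Module.length B (B ⧸ frobeniusPower (maximalIdeal B) (p ^ e)) =
      Module.length A (A ⧸ frobeniusPower (maximalIdeal A) (p ^ e)) *
        ((p ^ e : ℕ) : ℕ∞) ^ d := by
  set mB := (maximalIdeal A).map (algebraMap A B) with hmB
  obtain ⟨ys, hys, hdim⟩ := exists_list_ofList_eq_maximalIdeal (B ⧸ mB)
  obtain ⟨rs, rfl⟩ : ∃ rs : List B, rs.map (Ideal.Quotient.mk mB) = ys :=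
    List.map_surjective_iff.mpr Ideal.Quotient.mk_surjective ys
  have hlen : rs.length = d := by
    rw [hd] at hdim
    simpa using (Nat.cast_injective hdim).symm
  -- `m_B` is the preimage of the maximal ideal of the fiber, which the lifts `rs` generate.
  have hn : maximalIdeal B = mB ⊔ Ideal.ofList rs := by
    have h : (Ideal.ofList rs).map (Ideal.Quotient.mk mB) =
        (maximalIdeal B).map (Ideal.Quotient.mk mB) := by
      rw [Ideal.map_ofList, hys, map_maximalIdeal_of_surjective _ Ideal.Quotient.mk_surjective]
    have hle : mB ≤ maximalIdeal B := map_maximalIdeal_le (algebraMap A B)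
    have h' := congrArg (Ideal.comap (Ideal.Quotient.mk mB)) h
    rw [Ideal.comap_map_of_surjective' _ Ideal.Quotient.mk_surjective,
      Ideal.comap_map_of_surjective' _ Ideal.Quotient.mk_surjective, Ideal.mk_ker,
      sup_eq_left.mpr hle] at h'
    rw [← h', sup_comm]
  have e₀ : (B ⧸ mB) ≃ₗ[B] B ⊗[A] (A ⧸ maximalIdeal A) :=
    (Algebra.TensorProduct.quotIdealMapEquivTensorQuot B (maximalIdeal A)).toLinearEquiv
  have e₁ : (B ⧸ (frobeniusPower (maximalIdeal A) (p ^ e)).map (algebraMap A B)) ≃ₗ[B]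
      B ⊗[A] (A ⧸ frobeniusPower (maximalIdeal A) (p ^ e)) :=
    (Algebra.TensorProduct.quotIdealMapEquivTensorQuot B _).toLinearEquiv
  have hreg : IsWeaklyRegular (B ⧸ mB) rs :=
    (isWeaklyRegular_map_algebraMap_iff (B ⧸ mB) (B ⧸ mB) rs).mp
      (isWeaklyRegular_of_ofList_eq_maximalIdeal hys hdim)
  obtain ⟨hpow, hlpow⟩ := isWeaklyRegular_and_length_map_pow hreg (p ^ e)
  have hsimple : IsSimpleModule B (B ⧸ maximalIdeal B) :=
    isSimpleModule_iff_quot_maximal.mpr ⟨_, maximalIdeal.isMaximal B, ⟨.refl _ _⟩⟩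
  rw [length_quotient_quotient_ofList mB rs, ← hn,
    Module.length_eq_one B (B ⧸ maximalIdeal B), mul_one, hlen] at hlpow
  obtain ⟨-, hbc⟩ := isWeaklyRegular_and_length_baseChange ((e₀.isWeaklyRegular_congr _).mp hpow)
    (isFiniteLength_quotient_frobeniusPower (A := A) (q := p ^ e)
      (pow_ne_zero e (Fact.out : p.Prime).ne_zero))
  rw [← length_quotient_ofList_congr e₀, hlpow, ← length_quotient_ofList_congr e₁,
    length_quotient_quotient_ofList, ← frobeniusPower_map, ← frobeniusPower_ofList,
    ← frobeniusPower_sup, ← hn] at hbc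
  exact hbc

/-- Already the normalized Hilbert-Kunz functions agree along a flat local extension with regular
closed fiber. -/
theorem hilbertKunzFunction_eq_of_flat [IsNoetherianRing B] (p : ℕ) [Fact p.Prime] [CharP A p]
    [CharP B p]
    [IsRegularLocalRing (B ⧸ (maximalIdeal A).map (algebraMap A B))] :
    hilbertKunzFunction p B = hilbertKunzFunction p A := by
  funext e
  obtain ⟨rs, -, hd⟩ :=
    exists_list_ofList_eq_maximalIdeal (B ⧸ (maximalIdeal A).map (algebraMap A B))
  have hdim := ringKrullDim_eq_add_of_flat (A := A) (B := B)
  have hA : ringKrullDim A = ((maximalIdeal A).height.toNat : ℕ) := by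
    rw [← maximalIdeal_height_eq_ringKrullDim]
    exact_mod_cast (ENat.natCast_toNat (Ideal.height_ne_top Ideal.IsPrime.ne_top')).symm
  rw [hd, hA, ← Nat.cast_add] at hdim
  have hp : (p : ℝ) ≠ 0 := Nat.cast_ne_zero.mpr (Fact.out : p.Prime).ne_zero
  have htoNat : ∀ n : ℕ, (((n : WithBot ℕ∞)).unbotD 0).toNat = n := fun n => rfl
  rw [hilbertKunzFunction, hilbertKunzFunction, length_quotient_frobeniusPower_eq p hd e, hdim, hA,
    htoNat, htoNat, ENat.toNat_mul, ← Nat.cast_pow, ENat.toNat_natCast, mul_add, pow_add, Nat.cast_mul,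
    Nat.cast_pow, Nat.cast_pow, ← pow_mul]
  exact mul_div_mul_right _ _ (pow_ne_zero _ hp)

end LocalExtension

/-! ### Hilbert-Kunz multiplicities on spectra -/

lemma charP_localization_atPrime (p : ℕ) [Fact p.Prime] {R : Type*} [CommRing R] [CharP R p]
    (P : Ideal R) [P.IsPrime] : CharP (Localization.AtPrime P) p := by
  rw [CharP.charP_iff_prime_eq_zero Fact.out, ← map_natCast (algebraMap R _), CharP.cast_eq_zero,
    map_zero]

/-- The Hilbert-Kunz multiplicity of `S` at a prime, given as a prime of a regular fiber, is that of
`R` at the base point of the fiber. -/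
lemma hilbertKunzSpec_comap_includeRight (p : ℕ) [Fact p.Prime]
    {R : Type*} [CommRing R] [IsNoetherianRing R] [CharP R p]
    {S : Type*} [CommRing S] [IsNoetherianRing S] [CharP S p] [Algebra R S] [Module.Flat R S]
    (y : PrimeSpectrum R) [IsRegularRing (y.asIdeal.Fiber S)]
    (q : PrimeSpectrum (y.asIdeal.Fiber S)) :
    hilbertKunzSpec p S (PrimeSpectrum.comap
      (Algebra.TensorProduct.includeRight : S →ₐ[R] y.asIdeal.Fiber S).toRingHom q) =
        hilbertKunzSpec p R y := by
  let r : Ideal S := q.asIdeal.comap Algebra.TensorProduct.includeRight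
  let P := y.asIdeal
  change hilbertKunzMultiplicity p (Localization.AtPrime r) =
    hilbertKunzMultiplicity p (Localization.AtPrime P)
  let : Algebra (Localization.AtPrime P) (Localization.AtPrime r) :=
    Localization.AtPrime.algebraOfLiesOver P r
  have : Localization.AtPrime.IsLiesOverAlgebra P r := ⟨rfl⟩
  have : IsLocalHom (algebraMap (Localization.AtPrime P) (Localization.AtPrime r)) :=
    Localization.isLocalHom_localRingHom P r (algebraMap R S) Ideal.LiesOver.over
  have := charP_localization_atPrime p P
  have := charP_localization_atPrime p r
  have hideal : (maximalIdeal (Localization.AtPrime P)).map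
      (algebraMap (Localization.AtPrime P) (Localization.AtPrime r)) =
        P.map (algebraMap R (Localization.AtPrime r)) := by
    rw [← Localization.AtPrime.map_eq_maximalIdeal, Ideal.map_map,
      ← IsScalarTower.algebraMap_eq]
  have : IsRegularLocalRing (Localization.AtPrime r ⧸ (maximalIdeal (Localization.AtPrime P)).map
      (algebraMap (Localization.AtPrime P) (Localization.AtPrime r))) :=
    .of_ringEquiv (R := Localization.AtPrime q.asIdeal) ((Ideal.Fiber.localizationAlgEquivQuotient P q.asIdeal).toRingEquiv.trans
      (Ideal.quotEquivOfEq hideal.symm))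
  rw [hilbertKunzMultiplicity, hilbertKunzMultiplicity,
    hilbertKunzFunction_eq_of_flat (A := Localization.AtPrime P) p]

/-- Along a flat algebra with regular fibers, the Hilbert-Kunz function on `Spec S` is the pullback
of the one on `Spec R`. -/
theorem hilbertKunzSpec_eq_comp (p : ℕ) [Fact p.Prime]
    {R : Type*} [CommRing R] [IsNoetherianRing R] [CharP R p]
    {S : Type*} [CommRing S] [IsNoetherianRing S] [CharP S p] [Algebra R S] [Module.Flat R S]
    (hfib : HasRegularFibers R S) :
    hilbertKunzSpec p S = hilbertKunzSpec p R ∘ PrimeSpectrum.comap (algebraMap R S) := by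
  funext x
  have := hfib (PrimeSpectrum.comap (algebraMap R S) x)
  obtain ⟨q, hq⟩ := (PrimeSpectrum.preimageEquivFiber R S
    (PrimeSpectrum.comap (algebraMap R S) x)).symm.surjective ⟨x, rfl⟩
  have hx := congrArg (hilbertKunzSpec p S) (congrArg Subtype.val hq)
  exact hx.symm.trans (hilbertKunzSpec_comap_includeRight p _ q)

end HilbertKunz

theorem mainTheorem6 (p : ℕ) [Fact p.Prime]
    (R : Type*) [CommRing R] [IsNoetherianRing R] [CharP R p]
    (S : Type*) [CommRing S] [IsNoetherianRing S] [Algebra R S]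
    [Module.FaithfullyFlat R S] (hfib : HasRegularFibers R S) :
    UpperSemicontinuous (hilbertKunzSpec p S) ↔ UpperSemicontinuous (hilbertKunzSpec p R) := by
  have : Nontrivial R := CharP.nontrivial_of_char_ne_one (Fact.out : p.Prime).ne_one
  have : Nontrivial S := (FaithfulSMul.algebraMap_injective R S).nontrivial
  have : CharP S p := by
    rw [CharP.charP_iff_prime_eq_zero Fact.out, ← map_natCast (algebraMap R S),
      CharP.cast_eq_zero, map_zero]
  have hquot : Topology.IsQuotientMap (PrimeSpectrum.comap (algebraMap R S)) :=
    PrimeSpectrum.isQuotientMap_of_generalizingMap PrimeSpectrum.comap_surjective_of_faithfullyFlat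
      (Algebra.HasGoingDown.iff_generalizingMap_primeSpectrumComap.mp inferInstance)
  simp_rw [upperSemicontinuous_iff_isOpen_preimage, hilbertKunzSpec_eq_comp p hfib,
    Set.preimage_comp, hquot.isOpen_preimage]
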